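/- Consider road travel times $T_m>0$ ($m=1,2,\dots$) on a fixed bus link, observed together with a vector $X_m=(X_{m1},\dots,X_{m4})\in\{0,1\}^4$ of four binary covariates (rain, peak hour, weekday, traffic). Let $Z_m=(1,X_{m1},\dots,X_{m4})\in\mathbb{R}^5$ be the regressor vector with intercept. Assume: (1) the observations $(X_m,T_m)$ are independent and identically distributed, and for some $\theta_0=(\beta_0,\gamma_0)\in\mathbb{R}^5\times\mathbb{R}^5$, conditionally on $X_m$ the variable $Y_m=\ln T_m$ is normal with mean $\beta_0^{T}Z_m$ and variance $\exp(\gamma_0^{T}Z_m)$; (2) the regressors are linearly independent: if $c\in\mathbb{R}^5$ and $c^{T}Z_1=0$ almost surely, then $c=0$. For $\theta=(\beta,\gamma)\in\mathbb{R}^5\times\mathbb{R}^5$ put $\mu_m=\beta^{T}Z_m$, $\sigma_m^2=\exp(\gamma^{T}Z_m)$ and $$\ln L_n(\theta)=-\frac n2\ln(2\pi)-\sum_{m=1}^n\ln\sigma_m-\sum_{m=1}^n\frac{(Y_m-\mu_m)^2}{2\sigma_m^2}.$$ Then the probability that $\ln L_n$ has a global maximizer tends to $1$ as $n\to\infty$,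 and the maximum likelihood estimator is consistent: if $\hat\theta_n$ almost surely is a global maximizer of $\ln L_n$ whenever one exists (and is arbitrary otherwise), then $\hat\theta_n\to\theta_0$ in probability, that is, $P(\|\hat\theta_n-\theta_0\|>\varepsilon)\to0$ for every $\varepsilon>0$. The same holds for the model without intercept, in which $Z_m=X_m\in\mathbb{R}^4$ and $\theta,\theta_0\in\mathbb{R}^4\times\mathbb{R}^4$. -/

import Mathlib

open MeasureTheory ProbabilityTheory Filter Topology

noncomputable section

/-- Values of the four binary covariates of one observation, in the order
rain, peak hour, weekday, traffic. -/
abbrev Covariates : Type := Fin 4 → Bool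

/-- The covariates as a vector of zeros and ones in `ℝ⁴`. -/
def indicatorVec (x : Covariates) : Fin 4 → ℝ := fun j => if x j then 1 else 0

/-- The regressor vector `(1, x₁, x₂, x₃, x₄)`, whose first entry carries the
intercepts `β₀` and `γ₀`. -/
def interceptVec (x : Covariates) : Fin 5 → ℝ := Matrix.vecCons 1 (indicatorVec x)

/-- The parameter `θ = (β, γ)`. -/
abbrev Param (d : ℕ) : Type := (Fin d → ℝ) × (Fin d → ℝ)

/-- The mean `βᵀ z` of the log travel time at the regressor vector `z`. -/
def logMean {d : ℕ} (θ : Param d) (z : Fin d → ℝ) : ℝ := dotProduct θ.1 z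

/-- The variance `exp (γᵀ z)` of the log travel time at the regressor vector `z`. -/
def logVar {d : ℕ} (θ : Param d) (z : Fin d → ℝ) : ℝ := Real.exp (dotProduct θ.2 z)

/-- The standard deviation of the log travel time at the regressor vector `z`. -/
def logSd {d : ℕ} (θ : Param d) (z : Fin d → ℝ) : ℝ := Real.sqrt (logVar θ z)

/-- The log-normal distribution: the law of `exp Y` for `Y` normal with mean `m` and
variance `v`. -/
def logNormal (m : ℝ) (v : NNReal) : Measure ℝ := (gaussianReal m v).map Real.exp

/-- The heteroscedastic log-normal model with true parameter `θ₀`, for a sequence of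
observations `(X m, T m)` of covariates and road travel times on one link. The map `z`
(such as `interceptVec`) turns covariates into the regressor vector. -/
structure RoadTravelTimeModel {Ω : Type*} [MeasurableSpace Ω] (μ : Measure Ω) {d : ℕ}
    (z : Covariates → Fin d → ℝ) (X : ℕ → Ω → Covariates) (T : ℕ → Ω → ℝ)
    (θ₀ : Param d) : Prop where
  measurable_covariates : ∀ m, Measurable (X m)
  measurable_time : ∀ m, Measurable (T m)
  /-- The observations are independent. -/
  indep : iIndepFun (fun m ω => (X m ω, T m ω)) μ
  /-- The observations are identically distributed. -/
  identDistrib : ∀ m, IdentDistrib (fun ω => (X m ω, T m ω)) (fun ω => (X 0 ω, T 0 ω)) μ μ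
  /-- Given `X m = x`, the travel time is log-normal with parameters `βᵀ z` and
  `exp (γᵀ z)`, where `z = z x`. -/
  condLaw : ∀ m x, μ (X m ⁻¹' {x}) ≠ 0 →
    (μ[|X m ⁻¹' {x}]).map (T m) = logNormal (logMean θ₀ (z x)) (logVar θ₀ (z x)).toNNReal
  /-- The regressors are linearly independent as random variables: no nontrivial linear
  combination of them vanishes almost surely. -/
  linearIndep : ∀ c : Fin d → ℝ, (∀ᵐ ω ∂μ, dotProduct c (z (X 0 ω)) = 0) → c = 0

/-- The log-likelihood of `θ` for the first `n` observations, where `z m` is the regressor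
vector and `y m` the log travel time of the `m`-th one. -/
def logLikelihood {d : ℕ} (n : ℕ) (z : ℕ → Fin d → ℝ) (y : ℕ → ℝ) (θ : Param d) : ℝ :=
  -((n : ℝ) / 2) * Real.log (2 * Real.pi)
    - ∑ m ∈ Finset.range n, Real.log (logSd θ (z m))
    - ∑ m ∈ Finset.range n, (y m - logMean θ (z m)) ^ 2 / (2 * logSd θ (z m) ^ 2)

/-- `θ` is a maximum likelihood estimate for the first `n` observations: it maximizes the
log-likelihood over all parameters. -/
def IsMLE {d : ℕ} (n : ℕ) (z : ℕ → Fin d → ℝ) (y : ℕ → ℝ) (θ : Param d) : Prop :=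
  ∀ θ' : Param d, logLikelihood n z y θ' ≤ logLikelihood n z y θ

/-- `θ` is a maximum likelihood estimate from the first `n` observations `(X m ω, T m ω)`. -/
def IsMLEAt {Ω : Type*} {d : ℕ} (z : Covariates → Fin d → ℝ) (X : ℕ → Ω → Covariates)
    (T : ℕ → Ω → ℝ) (n : ℕ) (ω : Ω) (θ : Param d) : Prop :=
  IsMLE n (fun m => z (X m ω)) (fun m => Real.log (T m ω)) θ

/-- `θhat` is a maximum likelihood estimator: at almost every outcome at which a maximum
likelihood estimate exists, `θhat n` is one. (For small samples the likelihood may be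
unbounded; nothing is asked of `θhat n` there.) -/
def IsMLEstimator {Ω : Type*} [MeasurableSpace Ω] (μ : Measure Ω) {d : ℕ}
    (z : Covariates → Fin d → ℝ) (X : ℕ → Ω → Covariates) (T : ℕ → Ω → ℝ)
    (θhat : ℕ → Ω → Param d) : Prop :=
  ∀ n, ∀ᵐ ω ∂μ, (∃ θ, IsMLEAt z X T n ω θ) → IsMLEAt z X T n ω (θhat n ω)

end

/-! The log-likelihood depends on the data only through the empirical moments, in each cell
`X = x`, of the residuals standardized with the true parameter `θ₀`. Up to the factor `n / 2`, the
difference `ln L_n θ₀ - ln L_n θ` is the sum over the cells of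
`A u + e⁻ᵘ (C - 2 B w + A w²) - C`, where `A`, `B`, `C` are the empirical moments of order `0`, `1`,
`2` of the cell, `u = (γ - γ₀)ᵀ z` and `w = (β - β₀)ᵀ z / σ₀`.
By the law of large numbers `(A, B, C)` is close to `(p, 0, p)`, with `p` the probability of the
cell, and there the expression becomes `p` times `u + e⁻ᵘ - 1 + e⁻ᵘ w²` (`gaussianExcess`), which is
nonnegative, vanishes only at `(0, 0)`, and is bounded away from `0` off any neighbourhood of
`(0, 0)`. The perturbation of the moments costs only `6 δ (gaussianExcess + 1)`
(`cell_lower_bound`), uniformly in the unbounded variables `u` and `w`; this replaces any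
separate coercivity or compactness argument for large `θ`.

Since the regressor vectors of the cells of positive probability span the parameter space, `θ` far
from `θ₀` has `(u, w)` far from `(0, 0)` in some such cell. Hence, as soon as the moments are close
to their limits, `θ₀` beats every parameter outside a small ball (`logLikelihood_lt_of_moments`).
Then the maximum over the closed ball, which exists by compactness, is a global one, and all
global maximizers lie in the ball.

Neither the estimator nor the set of outcomes with a maximizer is assumed measurable, so the bad
events are bounded in outer measure by events about the moments. -/

/-! ### The excess of a normal likelihood -/

/-- Twice the Kullback–Leibler divergence `KL(P ‖ Q)` of the standard normal law `P` relative to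
the normal law `Q` with mean `w` and variance `exp u`. -/
noncomputable def gaussianExcess (u w : ℝ) : ℝ :=
  u + Real.exp (-u) - 1 + Real.exp (-u) * w ^ 2

lemma gaussianExcess_nonneg (u w : ℝ) : 0 ≤ gaussianExcess u w := by
  have h1 := Real.add_one_le_exp (-u)
  have h2 : 0 ≤ Real.exp (-u) * w ^ 2 := by positivity
  unfold gaussianExcess
  linarith

/-- The excess is bounded away from zero off every neighbourhood of `(0, 0)`. -/
lemma exists_le_gaussianExcess {ε : ℝ} (hε : 0 < ε) :
    ∃ κ > 0, ∀ u w : ℝ, (ε ≤ |u| ∨ ε ≤ |w|) → κ ≤ gaussianExcess u w := by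
  have hp : 0 < ε + Real.exp (-ε) - 1 := by
    have := Real.add_one_lt_exp (x := -ε) (by linarith)
    linarith
  have hm : 0 < -ε + Real.exp ε - 1 := by
    have := Real.add_one_lt_exp (x := ε) (by linarith)
    linarith
  have hw : 0 < Real.exp (-ε) * ε ^ 2 := by positivity
  refine ⟨min (min (ε + Real.exp (-ε) - 1) (-ε + Real.exp ε - 1)) (Real.exp (-ε) * ε ^ 2),
    lt_min (lt_min hp hm) hw, fun u w h => ?_⟩
  have hsq : 0 ≤ Real.exp (-u) * w ^ 2 := by positivity
  unfold gaussianExcess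
  by_cases hu : ε ≤ |u|
  · refine (min_le_left _ _).trans ?_
    -- The convex function `u + exp (-u) - 1` lies above its tangents at `ε` and at `-ε`.
    rcases le_abs.1 hu with hu | hu
    · refine (min_le_left _ _).trans ?_
      have h1 := Real.add_one_le_exp (-(u - ε))
      have h2 : Real.exp (-u) = Real.exp (-ε) * Real.exp (-(u - ε)) := by
        rw [← Real.exp_add]; ring_nf
      have h3 : Real.exp (-ε) ≤ 1 := Real.exp_le_one_iff.2 (by linarith)
      have h4 := mul_le_mul_of_nonneg_left h1 (Real.exp_pos (-ε)).le
      nlinarith [mul_nonneg (sub_nonneg.2 h3) (sub_nonneg.2 hu)]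
    · refine (min_le_right _ _).trans ?_
      have h1 := Real.add_one_le_exp (-u - ε)
      have h2 : Real.exp (-u) = Real.exp ε * Real.exp (-u - ε) := by
        rw [← Real.exp_add]; ring_nf
      have h3 : 1 ≤ Real.exp ε := Real.one_le_exp hε.le
      have h4 := mul_le_mul_of_nonneg_left h1 (Real.exp_pos ε).le
      nlinarith [mul_nonneg (sub_nonneg.2 h3) (sub_nonneg.2 hu)]
  · refine (min_le_right _ _).trans ?_
    have h1 : ε ≤ |w| := h.resolve_left hu
    have h2 : Real.exp (-ε) ≤ Real.exp (-u) :=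
      Real.exp_le_exp.2 (by linarith [le_abs_self u, not_le.1 hu])
    have h3 : ε ^ 2 ≤ w ^ 2 := by
      rw [← sq_abs w]; exact pow_le_pow_left₀ hε.le h1 2
    have h4 := mul_le_mul h2 h3 (by positivity) (Real.exp_pos _).le
    linarith [Real.add_one_le_exp (-u)]

/-- All the terms through which the moments enter are dominated by the excess, uniformly in
`u` and `w`. -/
lemma abs_add_exp_le_gaussianExcess (u w : ℝ) :
    |u| + 2 * Real.exp (-u) + 1 + 2 * (Real.exp (-u) * w ^ 2) ≤ 6 * (gaussianExcess u w + 1) := by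
  have hsq : 0 ≤ Real.exp (-u) * w ^ 2 := by positivity
  have hpos := Real.exp_pos (-u)
  unfold gaussianExcess
  rcases le_total 0 u with hu | hu
  · rw [abs_of_nonneg hu]
    linarith [Real.add_one_le_exp (-u)]
  · rw [abs_of_nonpos hu]
    -- `exp t ≥ 2 t` for every real `t`, here with `t = -u`.
    have h1 := Real.add_one_le_exp (-u - 1)
    have h2 : Real.exp (-u) = Real.exp 1 * Real.exp (-u - 1) := by
      rw [← Real.exp_add]; ring_nf
    have h3 : (2 : ℝ) ≤ Real.exp 1 := by linarith [Real.add_one_le_exp (1 : ℝ)]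
    have h4 : 2 * (-u) ≤ Real.exp (-u) := by
      rw [h2]; nlinarith [Real.exp_pos (-u - 1)]
    linarith [Real.add_one_le_exp (-u)]

/-- The contribution of one cell to the likelihood difference, when its moments `A`, `B`, `C` are
`δ`-close to their limits `p`, `0`, `p`. -/
lemma cell_lower_bound {A B C p δ : ℝ} (hA : |A - p| ≤ δ) (hB : |B| ≤ δ) (hC : |C - p| ≤ δ)
    (u w : ℝ) :
    p * gaussianExcess u w - 6 * δ * (gaussianExcess u w + 1) ≤
      A * u + Real.exp (-u) * (C - 2 * B * w + A * w ^ 2) - C := by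
  have hδ : 0 ≤ δ := (abs_nonneg _).trans hB
  have hE := Real.exp_pos (-u)
  have h1 : -(δ * |u|) ≤ (A - p) * u := by
    have := mul_le_mul_of_nonneg_right hA (abs_nonneg u)
    rw [← abs_mul] at this
    linarith [neg_abs_le ((A - p) * u)]
  have h2 : 2 * B * w ≤ δ * (1 + w ^ 2) := by
    have h := mul_le_mul_of_nonneg_right hB (abs_nonneg w)
    rw [← abs_mul] at h
    have h' := mul_nonneg hδ (sq_nonneg (|w| - 1))
    rw [sub_sq, sq_abs] at h'
    linarith [le_abs_self (B * w)]
  have h3 : -(δ * w ^ 2) ≤ (A - p) * w ^ 2 := by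
    nlinarith [neg_le_of_abs_le hA, sq_nonneg w]
  have h4 : -δ ≤ C - p := neg_le_of_abs_le hC
  have h5 : C - p ≤ δ := le_of_abs_le hC
  have h6 := mul_le_mul_of_nonneg_left
    (show p + p * w ^ 2 - δ * (2 + 2 * w ^ 2) ≤ C - 2 * B * w + A * w ^ 2 by linarith) hE.le
  have h7 := mul_le_mul_of_nonneg_left (abs_add_exp_le_gaussianExcess u w) hδ
  have h8 : p * gaussianExcess u w
      = p * u + Real.exp (-u) * (p + p * w ^ 2) - p := by
    unfold gaussianExcess; ring
  rw [h8]
  linarith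

/-! ### The likelihood in terms of cell moments -/

lemma logSd_pos {d : ℕ} (θ : Param d) (z : Fin d → ℝ) : 0 < logSd θ z :=
  Real.sqrt_pos.2 (Real.exp_pos _)

lemma logSd_sq {d : ℕ} (θ : Param d) (z : Fin d → ℝ) :
    logSd θ z ^ 2 = Real.exp (dotProduct θ.2 z) :=
  Real.sq_sqrt (Real.exp_pos _).le

lemma log_logSd {d : ℕ} (θ : Param d) (z : Fin d → ℝ) :
    Real.log (logSd θ z) = dotProduct θ.2 z / 2 := by
  rw [logSd, logVar, Real.log_sqrt (Real.exp_pos _).le, Real.log_exp]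

/-- The residual of the log travel time `y`, standardized with the parameter `θ`. -/
noncomputable def stdResidual {d : ℕ} (θ : Param d) (z : Fin d → ℝ) (y : ℝ) : ℝ :=
  (y - logMean θ z) / logSd θ z

/-- The logarithm of the ratio of the variances under `θ` and `θ₀`. -/
noncomputable def varShift {d : ℕ} (θ₀ θ : Param d) (z : Fin d → ℝ) : ℝ :=
  dotProduct (θ.2 - θ₀.2) z

/-- The difference of the means under `θ` and `θ₀`, in units of the standard deviation
under `θ₀`. -/
noncomputable def meanShift {d : ℕ} (θ₀ θ : Param d) (z : Fin d → ℝ) : ℝ :=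
  dotProduct (θ.1 - θ₀.1) z / logSd θ₀ z

/-- The empirical moment of order `k` of the standardized residuals in the cell `x`. The sum over
the cell is divided by the total number `n` of observations, not by the number of those in the
cell. -/
noncomputable def cellMoment {d : ℕ} (θ₀ : Param d) (z : Covariates → Fin d → ℝ)
    (X : ℕ → Covariates) (y : ℕ → ℝ) (n : ℕ) (x : Covariates) (k : ℕ) : ℝ :=
  (∑ m ∈ Finset.range n, if X m = x then stdResidual θ₀ (z x) (y m) ^ k else 0) / n

lemma observation_logLikelihood_sub {d : ℕ} (θ₀ θ : Param d) (z : Fin d → ℝ) (y : ℝ) :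
    (Real.log (logSd θ z) + (y - logMean θ z) ^ 2 / (2 * logSd θ z ^ 2))
      - (Real.log (logSd θ₀ z) + (y - logMean θ₀ z) ^ 2 / (2 * logSd θ₀ z ^ 2))
    = (varShift θ₀ θ z + Real.exp (-varShift θ₀ θ z)
        * (stdResidual θ₀ z y - meanShift θ₀ θ z) ^ 2 - stdResidual θ₀ z y ^ 2) / 2 := by
  have h0 := logSd_pos θ₀ z
  have hu : Real.exp (-varShift θ₀ θ z) = logSd θ₀ z ^ 2 / logSd θ z ^ 2 := by
    rw [logSd_sq, logSd_sq, ← Real.exp_sub, varShift, sub_dotProduct]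
    ring_nf
  have hres : stdResidual θ₀ z y - meanShift θ₀ θ z = (y - logMean θ z) / logSd θ₀ z := by
    rw [stdResidual, meanShift, ← sub_div, sub_dotProduct, logMean, logMean]
    ring_nf
  rw [hu, hres, log_logSd, log_logSd, varShift, sub_dotProduct, stdResidual]
  have h1 := logSd_pos θ z
  field_simp
  ring

lemma logLikelihood_sub {d n : ℕ} (hn : 0 < n) (θ₀ θ : Param d) (z : Covariates → Fin d → ℝ)
    (X : ℕ → Covariates) (y : ℕ → ℝ) :
    logLikelihood n (fun m => z (X m)) y θ₀ - logLikelihood n (fun m => z (X m)) y θ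
    = n / 2 * ∑ x, (cellMoment θ₀ z X y n x 0 * varShift θ₀ θ (z x)
        + Real.exp (-varShift θ₀ θ (z x)) * (cellMoment θ₀ z X y n x 2
          - 2 * cellMoment θ₀ z X y n x 1 * meanShift θ₀ θ (z x)
          + cellMoment θ₀ z X y n x 0 * meanShift θ₀ θ (z x) ^ 2)
        - cellMoment θ₀ z X y n x 2) := by
  have hn' : (n : ℝ) ≠ 0 := by positivity
  set f : Covariates → ℝ → ℝ := fun x t => (varShift θ₀ θ (z x) + Real.exp (-varShift θ₀ θ (z x))
    * (stdResidual θ₀ (z x) t - meanShift θ₀ θ (z x)) ^ 2 - stdResidual θ₀ (z x) t ^ 2) / 2 with hf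
  have h1 : logLikelihood n (fun m => z (X m)) y θ₀ - logLikelihood n (fun m => z (X m)) y θ
      = ∑ m ∈ Finset.range n, f (X m) (y m) := by
    simp only [hf, ← observation_logLikelihood_sub, Finset.sum_sub_distrib,
      Finset.sum_add_distrib, logLikelihood]
    ring
  have h2 : ∑ m ∈ Finset.range n, f (X m) (y m)
      = ∑ x, ∑ m ∈ Finset.range n, if X m = x then f x (y m) else 0 := by
    rw [Finset.sum_comm]
    refine Finset.sum_congr rfl fun m _ => ?_
    rw [Finset.sum_ite_eq]
    simp
  rw [h1, h2, Finset.mul_sum]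
  refine Finset.sum_congr rfl fun x _ => ?_
  have hk : ∀ k, n * cellMoment θ₀ z X y n x k
      = ∑ m ∈ Finset.range n, if X m = x then stdResidual θ₀ (z x) (y m) ^ k else 0 :=
    fun k => mul_div_cancel₀ _ hn'
  set u := varShift θ₀ θ (z x)
  set w := meanShift θ₀ θ (z x)
  have h3 : ∀ a b c : ℝ, (n : ℝ) / 2 * (a * u + Real.exp (-u) * (c - 2 * b * w + a * w ^ 2) - c)
      = (u / 2 + Real.exp (-u) * w ^ 2 / 2) * (n * a) + (-(Real.exp (-u) * w)) * (n * b)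
        + (Real.exp (-u) / 2 - 1 / 2) * (n * c) := by
    intro a b c; ring
  rw [h3, hk, hk, hk, Finset.mul_sum, Finset.mul_sum, Finset.mul_sum, ← Finset.sum_add_distrib,
    ← Finset.sum_add_distrib]
  refine Finset.sum_congr rfl fun m _ => ?_
  split_ifs
  · simp only [hf]; ring
  · ring

lemma continuous_logLikelihood {d n : ℕ} (z : ℕ → Fin d → ℝ) (y : ℕ → ℝ) :
    Continuous (logLikelihood n z y) := by
  have h : logLikelihood n z y = fun θ => -((n : ℝ) / 2) * Real.log (2 * Real.pi)
      - ∑ m ∈ Finset.range n, dotProduct θ.2 (z m) / 2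
      - ∑ m ∈ Finset.range n,
        (y m - dotProduct θ.1 (z m)) ^ 2 / (2 * Real.exp (dotProduct θ.2 (z m))) := by
    funext θ
    simp only [logLikelihood, log_logSd, logSd_sq, logMean]
  rw [h]
  simp only [dotProduct]
  refine (continuous_const.sub (by fun_prop)).sub (continuous_finsetSum _ fun m _ => ?_)
  exact Continuous.div (by fun_prop) (by fun_prop) fun θ => by positivity

/-! ### Identifiability and separation -/

/-- If the regressor vectors of the cells in `s` span, then a coefficient vector is controlled by
its values on these cells. -/
lemma exists_norm_le_of_abs_dotProduct_le {d : ℕ} {z : Covariates → Fin d → ℝ}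
    {s : Set Covariates} (hz : ∀ c : Fin d → ℝ, (∀ x ∈ s, dotProduct c (z x) = 0) → c = 0) :
    ∃ K > 0, ∀ (c : Fin d → ℝ) (r : ℝ), 0 ≤ r → (∀ x ∈ s, |dotProduct c (z x)| ≤ r) →
      ‖c‖ ≤ K * r := by
  classical
  let L : (Fin d → ℝ) →ₗ[ℝ] (s → ℝ) :=
    { toFun := fun c x => dotProduct c (z x)
      map_add' := fun a b => by ext x; simp [add_dotProduct]
      map_smul' := fun a b => by ext x; simp [smul_dotProduct] }
  have hL : LinearMap.ker L = ⊥ := by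
    rw [LinearMap.ker_eq_bot']
    exact fun c hc => hz c fun x hx => congrFun hc ⟨x, hx⟩
  obtain ⟨K, hK, hlip⟩ := L.exists_antilipschitzWith hL
  refine ⟨K, by exact_mod_cast hK, fun c r hr h => ?_⟩
  have h1 := hlip.le_mul_dist c 0
  rw [map_zero, dist_zero_right, dist_zero_right] at h1
  refine h1.trans (mul_le_mul_of_nonneg_left ?_ K.2)
  exact (pi_norm_le_iff_of_nonneg hr).2 fun x => h x x.2

/-- A parameter far from the true one is visibly shifted, in log variance or in standardized mean,
in one of the cells of `s`. -/
lemma exists_shift_ge {d : ℕ} {z : Covariates → Fin d → ℝ} {s : Set Covariates}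
    (hz : ∀ c : Fin d → ℝ, (∀ x ∈ s, dotProduct c (z x) = 0) → c = 0) (θ₀ : Param d)
    {ε : ℝ} (hε : 0 < ε) :
    ∃ η > 0, ∀ θ : Param d, ε ≤ dist θ θ₀ →
      ∃ x ∈ s, η ≤ |varShift θ₀ θ (z x)| ∨ η ≤ |meanShift θ₀ θ (z x)| := by
  obtain ⟨K, hK, h⟩ := exists_norm_le_of_abs_dotProduct_le hz
  set M : ℝ := 1 + ∑ x, logSd θ₀ (z x)
  have hsd : ∀ x, logSd θ₀ (z x) ≤ M := fun x => by
    have := Finset.single_le_sum (f := fun x => logSd θ₀ (z x))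
      (fun x _ => (logSd_pos θ₀ (z x)).le) (Finset.mem_univ x)
    linarith
  have hM1 : 1 ≤ M := by
    have : 0 ≤ ∑ x, logSd θ₀ (z x) := Finset.sum_nonneg fun x _ => (logSd_pos θ₀ (z x)).le
    linarith
  have hM0 : 0 < M := by linarith
  have hη : 0 < ε / (2 * K * M) := by positivity
  refine ⟨ε / (2 * K * M), hη, fun θ hθ => ?_⟩
  by_contra! hcon
  set η := ε / (2 * K * M) with hηdef
  have hr : K * (M * η) = ε / 2 := by rw [hηdef]; field_simp
  have hmul : η ≤ M * η := le_mul_of_one_le_left hη.le hM1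
  have h1 : ‖θ.1 - θ₀.1‖ ≤ ε / 2 := by
    rw [← hr]
    refine h _ _ (by positivity) fun x hx => ?_
    have h2 := (hcon x hx).2.le
    rw [meanShift, abs_div, abs_of_pos (logSd_pos _ _), div_le_iff₀ (logSd_pos _ _)] at h2
    rw [mul_comm M]
    exact h2.trans (mul_le_mul_of_nonneg_left (hsd x) hη.le)
  have h2 : ‖θ.2 - θ₀.2‖ ≤ ε / 2 := by
    rw [← hr]
    exact h _ _ (by positivity) fun x hx => (hcon x hx).1.le.trans hmul
  have h3 : dist θ θ₀ ≤ ε / 2 := by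
    rw [Prod.dist_eq, dist_eq_norm, dist_eq_norm]
    exact max_le h1 h2
  linarith

/-- Once the cell moments are close enough to their limits, the true parameter has a larger
likelihood than every parameter outside the ball of radius `ε` around it. -/
lemma logLikelihood_lt_of_moments {d : ℕ} {z : Covariates → Fin d → ℝ} {p : Covariates → ℝ}
    (hp : ∀ x, 0 ≤ p x)
    (hz : ∀ c : Fin d → ℝ, (∀ x ∈ {x | p x ≠ 0}, dotProduct c (z x) = 0) → c = 0)
    (θ₀ : Param d) {ε : ℝ} (hε : 0 < ε) :
    ∃ δ > 0, ∀ (n : ℕ) (X : ℕ → Covariates) (y : ℕ → ℝ), 0 < n → (∀ m, p (X m) ≠ 0) →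
      (∀ x, p x ≠ 0 → |cellMoment θ₀ z X y n x 0 - p x| < δ ∧
        |cellMoment θ₀ z X y n x 1| < δ ∧ |cellMoment θ₀ z X y n x 2 - p x| < δ) →
      ∀ θ, ε ≤ dist θ θ₀ →
        logLikelihood n (fun m => z (X m)) y θ < logLikelihood n (fun m => z (X m)) y θ₀ := by
  obtain ⟨η, hη, hshift⟩ := exists_shift_ge hz θ₀ hε
  obtain ⟨κ, hκ, hexcess⟩ := exists_le_gaussianExcess hη
  -- `δ` has to be small against every positive `p x`; there are finitely many of them.
  have hsmall : ∀ᶠ δ in 𝓝[>] (0 : ℝ), ∀ x, p x ≠ 0 →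
      6 * δ < p x / 2 ∧ Fintype.card Covariates * (6 * δ) < p x / 2 * κ := by
    refine eventually_all.2 fun x => ?_
    by_cases hx : p x = 0
    · exact Eventually.of_forall fun δ h => absurd hx h
    have hpx : 0 < p x := (hp x).lt_of_ne' hx
    have h1 : Tendsto (fun δ : ℝ => 6 * δ) (𝓝[>] 0) (𝓝 0) :=
      ((continuous_const.mul continuous_id).tendsto' 0 0 (by simp)).mono_left nhdsWithin_le_nhds
    have h2 : Tendsto (fun δ : ℝ => Fintype.card Covariates * (6 * δ)) (𝓝[>] 0) (𝓝 0) := by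
      simpa using h1.const_mul (Fintype.card Covariates : ℝ)
    filter_upwards [h1.eventually_lt_const (half_pos hpx),
      h2.eventually_lt_const (mul_pos (half_pos hpx) hκ)] with δ a b _ using ⟨a, b⟩
  obtain ⟨δ, hδ, hδ0⟩ := (hsmall.and self_mem_nhdsWithin).exists
  refine ⟨δ, hδ0, fun n X y hn hX hmom θ hθ => ?_⟩
  have hδ0' : (0 : ℝ) < δ := hδ0
  obtain ⟨x₀, hx₀, hfar⟩ := hshift θ hθ
  have hx₀' : p x₀ ≠ 0 := hx₀
  rw [← sub_pos, logLikelihood_sub hn]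
  refine mul_pos (by positivity) ?_
  set D : Covariates → ℝ := fun x => cellMoment θ₀ z X y n x 0 * varShift θ₀ θ (z x)
        + Real.exp (-varShift θ₀ θ (z x)) * (cellMoment θ₀ z X y n x 2
          - 2 * cellMoment θ₀ z X y n x 1 * meanShift θ₀ θ (z x)
          + cellMoment θ₀ z X y n x 0 * meanShift θ₀ θ (z x) ^ 2)
        - cellMoment θ₀ z X y n x 2 with hD
  change 0 < ∑ x, D x
  have hlow : ∀ x, p x ≠ 0 →
      p x / 2 * gaussianExcess (varShift θ₀ θ (z x)) (meanShift θ₀ θ (z x)) - 6 * δ ≤ D x := by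
    intro x hx
    obtain ⟨hA, hB, hC⟩ := hmom x hx
    have h1 := cell_lower_bound hA.le hB.le hC.le (varShift θ₀ θ (z x)) (meanShift θ₀ θ (z x))
    have h2 := mul_le_mul_of_nonneg_right (hδ x hx).1.le
      (gaussianExcess_nonneg (varShift θ₀ θ (z x)) (meanShift θ₀ θ (z x)))
    linarith
  -- A cell of probability zero is empty, so it contributes nothing.
  have hzero : ∀ x, p x = 0 → D x = 0 := by
    intro x hx
    have h1 : ∀ k, cellMoment θ₀ z X y n x k = 0 := fun k => by
      rw [cellMoment, Finset.sum_eq_zero, zero_div]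
      intro m _
      rw [if_neg]
      rintro rfl
      exact hX m hx
    simp [hD, h1]
  have hcell : ∀ x, -(6 * δ) ≤ D x := by
    intro x
    by_cases hx : p x = 0
    · rw [hzero x hx]; linarith
    · have h1 := mul_nonneg (div_nonneg (hp x) zero_le_two)
        (gaussianExcess_nonneg (varShift θ₀ θ (z x)) (meanShift θ₀ θ (z x)))
      linarith [hlow x hx]
  have hbig : p x₀ / 2 * κ ≤ D x₀ + 6 * δ := by
    have h1 := mul_le_mul_of_nonneg_left (hexcess _ _ hfar) (div_nonneg (hp x₀) zero_le_two)
    linarith [hlow x₀ hx₀']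
  have hsum : D x₀ + 6 * δ ≤ ∑ x, (D x + 6 * δ) :=
    Finset.single_le_sum (f := fun x => D x + 6 * δ)
      (fun x _ => by linarith [hcell x]) (Finset.mem_univ x₀)
  rw [Finset.sum_add_distrib, Finset.sum_const, nsmul_eq_mul, Finset.card_univ] at hsum
  linarith [(hδ x₀ hx₀').2]

lemma exists_isMLE_of_lt {d n : ℕ} {z : ℕ → Fin d → ℝ} {y : ℕ → ℝ} {θ₀ : Param d} {ε : ℝ}
    (hε : 0 < ε)
    (h : ∀ θ, ε ≤ dist θ θ₀ → logLikelihood n z y θ < logLikelihood n z y θ₀) :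
    ∃ θ, IsMLE n z y θ := by
  obtain ⟨θ, -, hmax⟩ := (isCompact_closedBall θ₀ ε).exists_isMaxOn
    ⟨θ₀, Metric.mem_closedBall_self hε.le⟩ (continuous_logLikelihood z y).continuousOn
  refine ⟨θ, fun θ' => ?_⟩
  rcases le_total (dist θ' θ₀) ε with h' | h'
  · exact hmax (Metric.mem_closedBall.2 h')
  · exact (h θ' h').le.trans (hmax (Metric.mem_closedBall_self hε.le))

lemma IsMLE.dist_lt {d n : ℕ} {z : ℕ → Fin d → ℝ} {y : ℕ → ℝ} {θ₀ θ : Param d} {ε : ℝ}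
    (h : ∀ θ, ε ≤ dist θ θ₀ → logLikelihood n z y θ < logLikelihood n z y θ₀)
    (hθ : IsMLE n z y θ) : dist θ θ₀ < ε := by
  by_contra! h'
  exact absurd (hθ θ₀) (not_le.2 (h θ h'))

/-! ### Convergence of the cell moments -/

lemma integrable_pow_gaussianReal (m : ℝ) (v : NNReal) (k : ℕ) :
    Integrable (fun t : ℝ => t ^ k) (gaussianReal m v) := by
  have h := (memLp_id_gaussianReal' (μ := m) (v := v) k
    (ENNReal.natCast_ne_top k)).integrable_norm_pow'
  refine h.mono (by fun_prop) (ae_of_all _ fun t => ?_)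
  simp

lemma integral_sq_gaussianReal_zero_one : ∫ t : ℝ, t ^ 2 ∂gaussianReal 0 1 = 1 := by
  have h := variance_fun_id_gaussianReal (μ := 0) (v := 1)
  rw [variance_eq_integral (by fun_prop)] at h
  simpa using h

lemma measurable_stdResidual {d : ℕ} (θ : Param d) (z : Fin d → ℝ) :
    Measurable (stdResidual θ z) := by
  unfold stdResidual; fun_prop

namespace RoadTravelTimeModel

variable {Ω : Type*} [MeasurableSpace Ω] {μ : Measure Ω} {d : ℕ} {z : Covariates → Fin d → ℝ}
  {X : ℕ → Ω → Covariates} {T : ℕ → Ω → ℝ} {θ₀ : Param d}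

lemma map_stdResidual (h : RoadTravelTimeModel μ z X T θ₀) {x : Covariates}
    (hx : μ (X 0 ⁻¹' {x}) ≠ 0) :
    (μ[|X 0 ⁻¹' {x}]).map (fun ω => stdResidual θ₀ (z x) (Real.log (T 0 ω)))
      = gaussianReal 0 1 := by
  have h0 := logSd_pos θ₀ (z x)
  have h1 : (μ[|X 0 ⁻¹' {x}]).map (fun ω => stdResidual θ₀ (z x) (Real.log (T 0 ω)))
      = (((μ[|X 0 ⁻¹' {x}]).map (T 0)).map Real.log).map (stdResidual θ₀ (z x)) := by
    rw [Measure.map_map (measurable_stdResidual _ _) Real.measurable_log,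
      Measure.map_map ((measurable_stdResidual _ _).comp Real.measurable_log)
        (h.measurable_time 0)]
    rfl
  have h2 : stdResidual θ₀ (z x)
      = (fun t => t / logSd θ₀ (z x)) ∘ (fun t => t - logMean θ₀ (z x)) := rfl
  rw [h1, h.condLaw 0 x hx, logNormal, Measure.map_map Real.measurable_log Real.measurable_exp]
  have h3 : Real.log ∘ Real.exp = id := funext Real.log_exp
  rw [h3, Measure.map_id, h2, ← Measure.map_map (by fun_prop) (by fun_prop),
    gaussianReal_map_sub_const, gaussianReal_map_div_const, sub_self, zero_div]
  congr 1
  ext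
  have h4 : 0 < logVar θ₀ (z x) := Real.exp_pos _
  have h5 : logSd θ₀ (z x) ^ 2 = logVar θ₀ (z x) := logSd_sq _ _
  simp [h5, h4.le, h4.ne']

/-- The expected moments of a single observation in a cell are those of the standard normal law,
weighted with the probability of the cell. -/
lemma integrable_and_integral_cell [IsProbabilityMeasure μ] (h : RoadTravelTimeModel μ z X T θ₀)
    {x : Covariates} (hx : μ (X 0 ⁻¹' {x}) ≠ 0) (k : ℕ) :
    Integrable (fun ω => if X 0 ω = x then stdResidual θ₀ (z x) (Real.log (T 0 ω)) ^ k else 0) μ ∧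
    ∫ ω, (if X 0 ω = x then stdResidual θ₀ (z x) (Real.log (T 0 ω)) ^ k else 0) ∂μ
      = μ.real (X 0 ⁻¹' {x}) * ∫ t, t ^ k ∂gaussianReal 0 1 := by
  have hS : MeasurableSet (X 0 ⁻¹' {x}) := h.measurable_covariates 0 (measurableSet_singleton x)
  have hm : Measurable (fun ω => stdResidual θ₀ (z x) (Real.log (T 0 ω))) :=
    (measurable_stdResidual _ _).comp (Real.measurable_log.comp (h.measurable_time 0))
  have hind : (fun ω => if X 0 ω = x then stdResidual θ₀ (z x) (Real.log (T 0 ω)) ^ k else 0)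
      = (X 0 ⁻¹' {x}).indicator (fun ω => stdResidual θ₀ (z x) (Real.log (T 0 ω)) ^ k) := by
    classical
    funext ω
    simp [Set.indicator_apply]
  have hint := integrable_pow_gaussianReal 0 1 k
  rw [← h.map_stdResidual hx, integrable_map_measure (by fun_prop) hm.aemeasurable,
    ProbabilityTheory.cond, integrable_smul_measure (by simp) (by simpa using hx)] at hint
  rw [hind, integrable_indicator_iff hS, integral_indicator hS]
  refine ⟨hint, ?_⟩
  rw [← h.map_stdResidual hx, integral_map hm.aemeasurable (by fun_prop), ProbabilityTheory.cond,
    integral_smul_measure, ENNReal.toReal_inv, smul_eq_mul, ← measureReal_def,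
    mul_inv_cancel_left₀]
  exact (measureReal_ne_zero_iff (measure_ne_top _ _)).2 hx

/-- The cell moments converge in probability, by the law of large numbers. -/
lemma tendsto_measure_cellMoment [IsProbabilityMeasure μ] (h : RoadTravelTimeModel μ z X T θ₀)
    {x : Covariates} (hx : μ (X 0 ⁻¹' {x}) ≠ 0) (k : ℕ) {δ : ℝ} (hδ : 0 < δ) :
    Tendsto (fun n => μ {ω | δ ≤ |cellMoment θ₀ z (fun m => X m ω)
      (fun m => Real.log (T m ω)) n x k
        - μ.real (X 0 ⁻¹' {x}) * ∫ t, t ^ k ∂gaussianReal 0 1|}) atTop (𝓝 0) := by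
  obtain ⟨hint, hval⟩ := h.integrable_and_integral_cell hx k
  set g : Covariates × ℝ → ℝ :=
    fun q => if q.1 = x then stdResidual θ₀ (z x) (Real.log q.2) ^ k else 0 with hg
  have hgm : Measurable g :=
    Measurable.ite (measurable_fst (measurableSet_singleton x))
      (((measurable_stdResidual _ _).comp (Real.measurable_log.comp measurable_snd)).pow_const k)
      measurable_const
  have hlln := strong_law_ae_real (fun m ω => g (X m ω, T m ω)) hint
    (fun i j hij => (h.indep.comp (fun _ => g) fun _ => hgm).indepFun hij)
    (fun m => (h.identDistrib m).comp hgm)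
  have hmeas : ∀ n : ℕ, Measurable
      (fun ω => (∑ m ∈ Finset.range n, g (X m ω, T m ω)) / (n : ℝ)) := fun n =>
    (Finset.measurable_fun_sum _ fun m _ =>
      hgm.comp ((h.measurable_covariates m).prodMk (h.measurable_time m))).div_const _
  have hconv := tendstoInMeasure_iff_dist.1
    (tendstoInMeasure_of_tendsto_ae (fun n => (hmeas n).aestronglyMeasurable) hlln) δ hδ
  rw [← hval]
  exact hconv

/-- Almost surely, no observation falls in a cell of probability zero. -/
lemma ae_cell_ne_zero [IsProbabilityMeasure μ] (h : RoadTravelTimeModel μ z X T θ₀) :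
    ∀ᵐ ω ∂μ, ∀ m, μ.real (X 0 ⁻¹' {X m ω}) ≠ 0 := by
  refine ae_all_iff.2 fun m => ?_
  have h1 : ∀ᵐ ω ∂μ, ∀ x, μ.real (X 0 ⁻¹' {x}) = 0 → X m ω ≠ x := by
    refine ae_all_iff.2 fun x => ?_
    by_cases hx : μ.real (X 0 ⁻¹' {x}) = 0
    · have h2 : μ (X m ⁻¹' {x}) = μ (X 0 ⁻¹' {x}) :=
        ((h.identDistrib m).comp measurable_fst).measure_mem_eq (measurableSet_singleton x)
      rw [measureReal_eq_zero_iff (measure_ne_top _ _), ← h2] at hx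
      filter_upwards [measure_eq_zero_iff_ae_notMem.1 hx] with ω hω _ using hω
    · exact ae_of_all _ fun ω h' => absurd h' hx
  filter_upwards [h1] with ω hω h0 using hω _ h0 rfl

/-- The probability that some parameter at distance at least `ε` from the true one has at least
its likelihood tends to zero. The event need not be measurable: the limit is one of outer
measures. -/
lemma tendsto_measure_not_separated [IsProbabilityMeasure μ]
    (h : RoadTravelTimeModel μ z X T θ₀) {ε : ℝ} (hε : 0 < ε) :
    Tendsto (fun n => μ {ω | ¬ ∀ θ, ε ≤ dist θ θ₀ →
      logLikelihood n (fun m => z (X m ω)) (fun m => Real.log (T m ω)) θ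
        < logLikelihood n (fun m => z (X m ω)) (fun m => Real.log (T m ω)) θ₀})
      atTop (𝓝 0) := by
  set p : Covariates → ℝ := fun x => μ.real (X 0 ⁻¹' {x}) with hpdef
  have hcells := h.ae_cell_ne_zero
  have hz : ∀ c : Fin d → ℝ, (∀ x ∈ {x | p x ≠ 0}, dotProduct c (z x) = 0) → c = 0 := by
    intro c hc
    refine h.linearIndep c ?_
    filter_upwards [hcells] with ω hω using hc _ (hω 0)
  obtain ⟨δ, hδ, hsep⟩ :=
    logLikelihood_lt_of_moments (fun x => measureReal_nonneg (s := X 0 ⁻¹' {x})) hz θ₀ hε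
  set bad : ℕ → Covariates → ℕ → Set Ω := fun n x k =>
    {ω | δ ≤ |cellMoment θ₀ z (fun m => X m ω) (fun m => Real.log (T m ω)) n x k
        - p x * ∫ t, t ^ k ∂gaussianReal 0 1|} with hbad
  have hlim : Tendsto (fun n => ∑ x, if p x ≠ 0 then
      μ (bad n x 0) + μ (bad n x 1) + μ (bad n x 2) else 0) atTop
      (𝓝 (∑ _x : Covariates, 0)) := by
    refine tendsto_finsetSum _ fun x _ => ?_
    split_ifs with hx
    · have hx' : μ (X 0 ⁻¹' {x}) ≠ 0 := fun h0 => hx (by simp [hpdef, measureReal_def, h0])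
      have hsum := ((h.tendsto_measure_cellMoment hx' 0 hδ).add
        (h.tendsto_measure_cellMoment hx' 1 hδ)).add (h.tendsto_measure_cellMoment hx' 2 hδ)
      rwa [add_zero, add_zero] at hsum
    · exact tendsto_const_nhds
  rw [Finset.sum_const_zero] at hlim
  refine tendsto_of_tendsto_of_tendsto_of_le_of_le' tendsto_const_nhds hlim
    (Eventually.of_forall fun n => zero_le) ?_
  filter_upwards [eventually_gt_atTop 0] with n hn
  have hsub : {ω | ¬ ∀ θ, ε ≤ dist θ θ₀ →
      logLikelihood n (fun m => z (X m ω)) (fun m => Real.log (T m ω)) θ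
        < logLikelihood n (fun m => z (X m ω)) (fun m => Real.log (T m ω)) θ₀}
      ≤ᵐ[μ] ⋃ x, if p x ≠ 0 then bad n x 0 ∪ bad n x 1 ∪ bad n x 2 else ∅ := by
    filter_upwards [hcells] with ω hω hω'
    by_contra hcon
    refine hω' (hsep n (fun m => X m ω) (fun m => Real.log (T m ω)) hn hω fun x hx => ?_)
    have h1 : ω ∉ bad n x 0 ∪ bad n x 1 ∪ bad n x 2 := by
      intro h2
      refine hcon (Set.mem_iUnion.2 ⟨x, ?_⟩)
      rwa [if_pos hx]
    simp only [hbad, Set.mem_union, Set.mem_ofPred_eq, not_or, not_le, pow_zero, pow_one,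
      integral_sq_gaussianReal_zero_one, integral_id_gaussianReal, integral_const, smul_eq_mul,
      probReal_univ, mul_one, mul_zero, sub_zero] at h1
    exact ⟨h1.1.1, h1.1.2, h1.2⟩
  refine (measure_mono_ae hsub).trans ((measure_iUnion_fintype_le _ _).trans ?_)
  refine Finset.sum_le_sum fun x _ => ?_
  split_ifs
  · exact (measure_union_le _ _).trans (add_le_add_left (measure_union_le _ _) _)
  · simp

/-! ### Existence and consistency of the maximum likelihood estimator -/

lemma tendsto_measure_exists_isMLEAt [IsProbabilityMeasure μ]
    (h : RoadTravelTimeModel μ z X T θ₀) :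
    Tendsto (fun n => μ {ω | ∃ θ, IsMLEAt z X T n ω θ}) atTop (𝓝 1) := by
  have hlim := ENNReal.Tendsto.sub (tendsto_const_nhds (x := (1 : ENNReal)))
    (h.tendsto_measure_not_separated one_pos) (Or.inl ENNReal.one_ne_top)
  rw [tsub_zero] at hlim
  refine tendsto_of_tendsto_of_tendsto_of_le_of_le hlim tendsto_const_nhds (fun n => ?_)
    fun n => prob_le_one
  rw [tsub_le_iff_right, ← measure_univ (μ := μ)]
  refine (measure_mono fun ω _ => ?_).trans (measure_union_le _ _)
  by_contra hcon
  rw [Set.mem_union, not_or] at hcon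
  exact hcon.1 (exists_isMLE_of_lt one_pos (not_not.1 hcon.2))

lemma tendstoInMeasure_of_isMLEstimator [IsProbabilityMeasure μ]
    (h : RoadTravelTimeModel μ z X T θ₀) {θhat : ℕ → Ω → Param d}
    (hθ : IsMLEstimator μ z X T θhat) : TendstoInMeasure μ θhat atTop (fun _ => θ₀) := by
  refine tendstoInMeasure_iff_dist.2 fun ε hε => ?_
  refine tendsto_of_tendsto_of_tendsto_of_le_of_le tendsto_const_nhds
    (h.tendsto_measure_not_separated hε) (fun n => zero_le) fun n => measure_mono_ae ?_
  filter_upwards [hθ n] with ω hω hfar hsep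
  exact absurd ((hω (exists_isMLE_of_lt hε hsep)).dist_lt hsep) (not_lt.2 hfar)

end RoadTravelTimeModel

theorem proposition1 {Ω : Type*} [MeasurableSpace Ω] (μ : Measure Ω) [IsProbabilityMeasure μ]
    (X : ℕ → Ω → Covariates) (T : ℕ → Ω → ℝ) :
    (∀ θ₀ : Param 5, RoadTravelTimeModel μ interceptVec X T θ₀ →
      Tendsto (fun n => μ {ω | ∃ θ, IsMLEAt interceptVec X T n ω θ}) atTop (𝓝 1) ∧
      ∀ θhat : ℕ → Ω → Param 5, IsMLEstimator μ interceptVec X T θhat →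
        TendstoInMeasure μ θhat atTop (fun _ => θ₀)) ∧
    (∀ θ₀ : Param 4, RoadTravelTimeModel μ indicatorVec X T θ₀ →
      Tendsto (fun n => μ {ω | ∃ θ, IsMLEAt indicatorVec X T n ω θ}) atTop (𝓝 1) ∧
      ∀ θhat : ℕ → Ω → Param 4, IsMLEstimator μ indicatorVec X T θhat →
        TendstoInMeasure μ θhat atTop (fun _ => θ₀)) := by
  exact ⟨fun _ h => ⟨h.tendsto_measure_exists_isMLEAt,
      fun _ hθ => h.tendstoInMeasure_of_isMLEstimator hθ⟩,
    fun _ h => ⟨h.tendsto_measure_exists_isMLEAt,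
      fun _ hθ => h.tendstoInMeasure_of_isMLEstimator hθ⟩⟩
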